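/- Let $p$ be a prime and let $\mathcal{O}$ be a complete discrete valuation ring with residue field $k$ of characteristic $p$ and field of fractions $K$ of characteristic $0$. An $\mathcal{O}$-algebra $A$ which is free of finite rank over $\mathcal{O}$ is symmetric if it has a symmetrising form, that is, an $\mathcal{O}$-linear map $s : A \to \mathcal{O}$ with $s(ab) = s(ba)$ for all $a, b \in A$ such that $a \mapsto (b \mapsto s(ab))$ is an isomorphism $A \cong A^* = \mathrm{Hom}_{\mathcal{O}}(A, \mathcal{O})$. For an $\mathcal{O}$-basis $X$ of $A$ with dual basis $\{x^\vee \mid x \in X\}$ with respect to $s$ (so $s(xy^\vee) = \delta_{x,y}$), the relative projective element of $A$ with respect to $s$ is $z_A = \sum_{x \in X} x x^\vee$; it does not depend on $X$. The algebra $A$ has the projective scalar property if it is symmetric and for some symmetrising form $s$ we have $z_A = \lambda 1_A$ with $\lambda \in \mathcal{O}$. An $A$-lattice is a left $A$-module that is free of finite rank over $\mathcal{O}$. It is irreducible if $K \otimes_{\mathcal{O}} V$ is a simple $K \otimes_{\mathcal{O}} A$-module. An indecomposable $A$-lattice $U$ is a Knörr lattice if $\mathrm{tr}_U(\alpha)\mathcal{O}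 \subseteq \mathrm{rank}_{\mathcal{O}}(U)\mathcal{O}$ for every $\alpha \in \mathrm{End}_A(U)$, with equality precisely when $\alpha$ is an automorphism; here $\mathrm{tr}_U$ is the trace on $\mathrm{End}_{\mathcal{O}}(U)$. Writing $n_p$ for the $p$-part of a positive integer $n$, the height of a nonzero $A$-lattice $U$ is the number $h(U)$ with $\mathrm{rank}_{\mathcal{O}}(U)_p = p^{m + h(U)}$, where $p^m = \min_V \mathrm{rank}_{\mathcal{O}}(V)_p$ and $V$ runs over all irreducible $A$-lattices. Heights of $A'$-lattices are defined in the same way with respect to $A'$. Theorem. Let $A$ and $A'$ be Morita equivalent $\mathcal{O}$-algebras (that is, their module categories are equivalent as $\mathcal{O}$-linear categories) which both have the projective scalar property, and suppose that $K \otimes_{\mathcal{O}} A$ is split semisimple. Let $U$ be a Knörr $A$-lattice and let $U'$ be an $A'$-module that corresponds to $U$ through a Morita equivalence between $A$ and $A'$. Then $U'$ is a Knörr $A'$-lattice and $h(U) = h(U')$. -/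

import Mathlib

open scoped TensorProduct

universe uO uK uA uA' u v

namespace SymmAlg

section Algebras

/-- A linear form `s : A → O` is a symmetrising form of the `O`-algebra `A` if `s (a b) = s (b a)`
and the map `A → A^* = Hom_O(A, O)`, `a ↦ (b ↦ s (a b))`, is bijective (it is then an isomorphism of
`A`-`A`-bimodules that sends `1` to `s`). -/
structure IsSymmetrisingForm {O : Type uO} [CommRing O] {A : Type uA} [Ring A] [Algebra O A]
    (s : A →ₗ[O] O) : Prop where
  symm : ∀ a b : A, s (a * b) = s (b * a)
  bijective : Function.Bijective (fun a : A => s ∘ₗ LinearMap.mulLeft O a)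

/-- `z` is the relative projective element (central Casimir element) `∑ x, x * x^∨` of `A` with
respect to the form `s`, where `x` runs over a finite `O`-basis of `A` and `x^∨` over its dual
basis. The sum does not depend on the basis. -/
def IsRelativeProjectiveElement {O : Type uO} [CommRing O] {A : Type uA} [Ring A] [Algebra O A]
    (s : A →ₗ[O] O) (z : A) : Prop :=
  ∃ (n : ℕ) (x : Module.Basis (Fin n) O A) (xd : Fin n → A),
    (∀ i j, s (x i * xd j) = if i = j then 1 else 0) ∧ z = ∑ i, x i * xd i

/-- The projective scalar property: `A` is symmetric, free of finite rank over `O`, and for some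
symmetrising form the relative projective element is a scalar multiple of the identity. -/
def HasProjectiveScalarProperty (O : Type uO) [CommRing O] (A : Type uA) [Ring A] [Algebra O A] :
    Prop :=
  ∃ s : A →ₗ[O] O, IsSymmetrisingForm s ∧
    ∃ c : O, IsRelativeProjectiveElement s (algebraMap O A c)

/-- A `K`-algebra is split semisimple if it is semisimple and every endomorphism of every simple
module is multiplication by an element of `K`. -/
structure IsSplitSemisimple (K : Type uK) [Field K] (B : Type u) [Ring B] [Algebra K B] :
    Prop where
  semisimple : IsSemisimpleRing B
  split : ∀ (S : Type u) [AddCommGroup S] [Module B S], IsSimpleModule B S →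
    ∀ f : Module.End B S, ∃ c : K, ∀ x : S, f x = algebraMap K B c • x

end Algebras

section Lattices

/-- An `A`-lattice is an `A`-module which is free of finite rank over `O`. -/
structure IsLattice (O : Type uO) [CommRing O] (U : Type u) [AddCommGroup U] [Module O U] :
    Prop where
  free : Module.Free O U
  finite : Module.Finite O U

/-- `U` is a nonzero `A`-module which is not the direct sum of two nonzero submodules. -/
structure IsIndecomposable (A : Type uA) [Ring A] (U : Type u) [AddCommGroup U] [Module A U] :
    Prop where
  nontrivial : Nontrivial U
  eq_bot_or_eq_bot : ∀ W W' : Submodule A U, IsCompl W W' → W = ⊥ ∨ W' = ⊥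

/-- A Knörr lattice: an indecomposable lattice `U` such that `tr_U(α) O ⊆ rank(U) O` for each
`A`-endomorphism `α` of `U`, with equality precisely when `α` is an automorphism. -/
structure IsKnorrLattice (O : Type uO) [CommRing O] (A : Type uA) [Ring A] [Algebra O A]
    (U : Type u) [AddCommGroup U] [Module O U] [Module A U] [IsScalarTower O A U] : Prop where
  isLattice : IsLattice O U
  isIndecomposable : IsIndecomposable A U
  trace_le : ∀ α : Module.End A U,
    Ideal.span {LinearMap.trace O U (α.restrictScalars O)} ≤
      Ideal.span {(Module.finrank O U : O)}
  trace_eq_iff : ∀ α : Module.End A U,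
    Ideal.span {LinearMap.trace O U (α.restrictScalars O)} =
      Ideal.span {(Module.finrank O U : O)} ↔ IsUnit α

/-- The action of `K ⊗ A` on `K ⊗ V`, for which `(c ⊗ a) (d ⊗ v) = c d ⊗ a v`. -/
noncomputable def scalarExtensionAction (O : Type uO) [CommRing O] (K : Type uK) [Field K]
    [Algebra O K] (A : Type uA) [Ring A] [Algebra O A]
    (V : Type v) [AddCommGroup V] [Module O V] [Module A V] [IsScalarTower O A V] :
    K ⊗[O] A →ₐ[K] Module.End K (K ⊗[O] V) :=
  (LinearMap.tensorProductEnd O K V).comp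
    (Algebra.TensorProduct.map (AlgHom.id K K) (Algebra.lsmul O O V))

theorem scalarExtensionAction_tmul (O : Type uO) [CommRing O] (K : Type uK) [Field K]
    [Algebra O K] (A : Type uA) [Ring A] [Algebra O A]
    (V : Type v) [AddCommGroup V] [Module O V] [Module A V] [IsScalarTower O A V]
    (c d : K) (a : A) (x : V) :
    scalarExtensionAction O K A V (c ⊗ₜ[O] a) (d ⊗ₜ[O] x) = (c * d) ⊗ₜ[O] (a • x) := by
  change (c • LinearMap.baseChange K (Algebra.lsmul O O V a)) (d ⊗ₜ[O] x) = _
  simp [TensorProduct.smul_tmul']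

/-- An `A`-lattice `V` is irreducible if `K ⊗ V` is a simple `K ⊗ A`-module. -/
structure IsIrreducibleLattice (O : Type uO) [CommRing O] (K : Type uK) [Field K] [Algebra O K]
    (A : Type uA) [Ring A] [Algebra O A]
    (V : Type v) [AddCommGroup V] [Module O V] [Module A V] [IsScalarTower O A V] : Prop where
  isLattice : IsLattice O V
  isSimple :
    letI : Module (K ⊗[O] A) (K ⊗[O] V) :=
      Module.compHom (K ⊗[O] V) (scalarExtensionAction O K A V).toRingHom
    IsSimpleModule (K ⊗[O] A) (K ⊗[O] V)

/-- The number `m` with `p ^ m = min_V rank(V)_p`, where `V` runs over all irreducible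
`A`-lattices. (Each `A`-lattice is isomorphic to a quotient of some `A ^ n`, so that the universe
of `A` contains a copy of each.) -/
noncomputable def minRankExponent (p : ℕ) (O : Type uO) [CommRing O] (K : Type uK) [Field K]
    [Algebra O K] (A : Type uA) [Ring A] [Algebra O A] : ℕ :=
  sInf {e : ℕ | ∃ (V : Type uA) (_ : AddCommGroup V) (_ : Module O V) (_ : Module A V)
    (_ : IsScalarTower O A V), IsIrreducibleLattice O K A V ∧
      e = padicValNat p (Module.finrank O V)}

/-- The height `h(U)` of an `A`-lattice `U`: `rank(U)_p = p ^ (m + h(U))`. -/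
noncomputable def height (p : ℕ) (O : Type uO) [CommRing O] (K : Type uK) [Field K]
    [Algebra O K] (A : Type uA) [Ring A] [Algebra O A]
    (U : Type u) [AddCommGroup U] [Module O U] : ℤ :=
  (padicValNat p (Module.finrank O U) : ℤ) - (minRankExponent p O K A : ℤ)

end Lattices

end SymmAlg

-- Write `z_A = c` and `z_{A'} = c'`. The regular character of a symmetric algebra is `a ↦ s (z_A
-- a)`, here `c s`, and `c ≠ 0` because a nonzero algebra has nonzero rank in characteristic 0.
-- Higman's trace writes `c • id` on any lattice `M` as a sum of maps through the regular module
-- `R`, so traces on `M` reduce to traces on `R`.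
--
-- For an equivalence `F`, the trace of `F(a)` on `F(R)` is `c'` times a symmetric form on `A`,
-- hence `c' s (z a)` with `z` central. It follows that `c tr_{FM}(F f) = c' tr_M(z f)` for every
-- lattice `M`. The same formula for the inverse equivalence forces `z` to be a unit
-- (`exists_central_unit_endTrace_functor_map`).
--
-- On a Knörr lattice `U` the action of `z` is an automorphism, so `f = id` gives `c rank U' ~ c'
-- rank U` up to units, and the Knörr conditions pass through `End U ≅ End U'`
-- (`IsKnorrLattice.of_trace_eq`). On an irreducible lattice `V` the action of `z` is a unit scalar
-- by splitness, so `c rank V' ~ c' rank V` too. All these `p`-exponents, and therefore their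
-- minimum, shift by the same amount (`height_eq_of_associated`). Irreducibility is transferred
-- through the criterion `HasTorsionQuotients`.

universe w w'

open CategoryTheory
open scoped ModuleCat.Algebra

namespace SymmAlg

/-! ### Dual bases, the regular character and Higman's trace. -/

section DualBasis

variable {O : Type uO} [CommRing O] {A : Type uA} [Ring A] [Algebra O A] {s : A →ₗ[O] O}
  {ι : Type*} [Fintype ι] [DecidableEq ι] {x : Module.Basis ι O A} {xd : ι → A}

theorem IsSymmetrisingForm.eq_of_forall (hs : IsSymmetrisingForm s) {a b : A}
    (h : ∀ d, s (a * d) = s (b * d)) : a = b :=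
  hs.bijective.injective (LinearMap.ext h)

theorem repr_eq_of_dual (hx : ∀ i j, s (x i * xd j) = if i = j then 1 else 0) (a : A) (i : ι) :
    x.repr a i = s (a * xd i) := by
  conv_rhs => rw [← x.sum_repr a]
  simp only [Finset.sum_mul, map_sum, smul_mul_assoc, map_smul, hx]
  simp

theorem sum_basis_of_dual (hx : ∀ i j, s (x i * xd j) = if i = j then 1 else 0) (a : A) :
    ∑ i, s (a * xd i) • x i = a := by
  conv_rhs => rw [← x.sum_repr a]
  simp [repr_eq_of_dual hx]

theorem IsSymmetrisingForm.sum_dual (hs : IsSymmetrisingForm s)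
    (hx : ∀ i j, s (x i * xd j) = if i = j then 1 else 0) (a : A) :
    ∑ i, s (x i * a) • xd i = a := by
  refine hs.eq_of_forall fun d => ?_
  rw [hs.symm, hs.symm a, ← sum_basis_of_dual hx d]
  simp only [Finset.sum_mul, Finset.mul_sum, map_sum, smul_mul_assoc, mul_smul_comm, map_smul, hx]
  simp [mul_comm]

/-- Expanding each `xd i` in the basis `x` gives the coefficients `s (xd i * xd j)`, which are
symmetric in `i` and `j`. -/
theorem IsSymmetrisingForm.sum_dual_mul_basis (hs : IsSymmetrisingForm s)
    (hx : ∀ i j, s (x i * xd j) = if i = j then 1 else 0) :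
    ∑ i, xd i * x i = ∑ i, x i * xd i := by
  have h1 : ∑ i, xd i * x i = ∑ i, ∑ j, s (xd i * xd j) • (x j * x i) := by
    refine Finset.sum_congr rfl fun i _ => ?_
    conv_lhs => rw [← sum_basis_of_dual hx (xd i)]
    simp [Finset.sum_mul]
  have h2 : ∑ i, x i * xd i = ∑ i, ∑ j, s (xd i * xd j) • (x i * x j) := by
    refine Finset.sum_congr rfl fun i _ => ?_
    conv_lhs => rw [← sum_basis_of_dual hx (xd i)]
    simp [Finset.mul_sum]
  rw [h1, h2, Finset.sum_comm]
  refine Finset.sum_congr rfl fun i _ => Finset.sum_congr rfl fun j _ => ?_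
  rw [hs.symm]

/-- The regular character of a symmetric algebra in terms of the relative projective element. -/
theorem IsSymmetrisingForm.trace_mulRight (hs : IsSymmetrisingForm s)
    (hx : ∀ i j, s (x i * xd j) = if i = j then 1 else 0) (a : A) :
    LinearMap.trace O A (LinearMap.mulRight O a) = s ((∑ i, x i * xd i) * a) := by
  rw [LinearMap.trace_eq_matrix_trace O x, ← hs.sum_dual_mul_basis hx, Matrix.trace]
  simp only [Matrix.diag_apply, LinearMap.toMatrix_apply, repr_eq_of_dual hx,
    LinearMap.mulRight_apply, Finset.sum_mul, map_sum]
  exact Finset.sum_congr rfl fun i _ => by rw [hs.symm, mul_assoc]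

/-- The `A`-linear map `∑ i, x i ⊗ f (xd i • ·)` obtained from an `O`-linear form by Higman's
trace. -/
noncomputable def higmanTrace (hs : IsSymmetrisingForm s)
    (hx : ∀ i j, s (x i * xd j) = if i = j then 1 else 0)
    {M : Type*} [AddCommGroup M] [Module O M] [Module A M] [IsScalarTower O A M]
    (f : M →ₗ[O] O) : M →ₗ[A] A where
  toFun m := ∑ i, f (xd i • m) • x i
  map_add' m n := by simp [add_smul, Finset.sum_add_distrib]
  map_smul' a m := by
    -- Expand `xd i * a` in the dual basis here and `a * x k` in the basis below; the coefficients
    -- agree by the symmetry of `s`.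
    have h1 : ∀ i, f (xd i • a • m) = ∑ k, s (x k * (xd i * a)) * f (xd k • m) := fun i => by
      rw [smul_smul]
      conv_lhs => rw [← hs.sum_dual hx (xd i * a)]
      simp [Finset.sum_smul]
    simp_rw [h1, RingHom.id_apply, smul_eq_mul, Finset.mul_sum, Finset.sum_smul]
    rw [Finset.sum_comm]
    refine Finset.sum_congr rfl fun k _ => ?_
    rw [mul_smul_comm]
    conv_rhs => rw [← sum_basis_of_dual hx (a * x k)]
    rw [Finset.smul_sum]
    refine Finset.sum_congr rfl fun i _ => ?_
    rw [smul_smul, mul_comm, ← mul_assoc (x k), hs.symm, ← mul_assoc]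

theorem higmanTrace_apply (hs : IsSymmetrisingForm s)
    (hx : ∀ i j, s (x i * xd j) = if i = j then 1 else 0)
    {M : Type*} [AddCommGroup M] [Module O M] [Module A M] [IsScalarTower O A M]
    (f : M →ₗ[O] O) (m : M) : higmanTrace hs hx f m = ∑ i, f (xd i • m) • x i := rfl

/-- The action of the relative projective element thus factors through a finite free `A`-module. -/
theorem sum_higmanTrace_coord (hs : IsSymmetrisingForm s)
    (hx : ∀ i j, s (x i * xd j) = if i = j then 1 else 0)
    {M : Type*} [AddCommGroup M] [Module O M] [Module A M] [IsScalarTower O A M]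
    {κ : Type*} [Fintype κ] (b : Module.Basis κ O M) (m : M) :
    ∑ j, higmanTrace hs hx (b.coord j) m • b j = (∑ i, x i * xd i) • m := by
  simp_rw [higmanTrace_apply, Finset.sum_smul]
  rw [Finset.sum_comm]
  refine Finset.sum_congr rfl fun i _ => ?_
  conv_rhs => rw [mul_smul, ← b.sum_repr (xd i • m), Finset.smul_sum]
  refine Finset.sum_congr rfl fun j _ => ?_
  rw [smul_comm (x i), smul_assoc]
  rfl

end DualBasis

/-! ### Traces of endomorphisms and the regular module. -/

section CategoryTrace

variable {O : Type uO} [CommRing O] {A : Type uA} [Ring A] [Algebra O A]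

/-- The `O`-linear trace of an endomorphism of a module over an `O`-algebra. -/
noncomputable def endTrace (O : Type uO) [CommRing O] {A : Type uA} [Ring A] [Algebra O A]
    (M : ModuleCat.{w} A) : (M ⟶ M) →ₗ[O] O where
  toFun f := LinearMap.trace O M (f.hom.restrictScalars O)
  map_add' f g := map_add (LinearMap.trace O M) (f.hom.restrictScalars O) (g.hom.restrictScalars O)
  map_smul' c f := map_smul (LinearMap.trace O M) c (f.hom.restrictScalars O)

theorem endTrace_apply {M : ModuleCat.{w} A} (f : M ⟶ M) :
    endTrace O M f = LinearMap.trace O M (f.hom.restrictScalars O) := rfl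

theorem endTrace_comp_comm {M N : ModuleCat.{w} A} (hM : IsLattice O M) (hN : IsLattice O N)
    (f : M ⟶ N) (g : N ⟶ M) : endTrace O M (f ≫ g) = endTrace O N (g ≫ f) := by
  have := hM.free
  have := hM.finite
  have := hN.free
  have := hN.finite
  exact LinearMap.trace_comp_comm' (f.hom.restrictScalars O) (g.hom.restrictScalars O)

/-- `M` embeds in `N ^ n`, and submodules of finite free modules over a principal ideal domain are
finite free. -/
theorem isLattice_of_jointly_injective [IsDomain O] [IsPrincipalIdealRing O] {n : ℕ}
    {M N : ModuleCat.{w} A} (hN : IsLattice O N) (σ : Fin n → (M ⟶ N))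
    (h : ∀ m : M, (∀ j, (σ j).hom m = 0) → m = 0) : IsLattice O M := by
  have := hN.free
  have := hN.finite
  let f : M →ₗ[O] (Fin n → N) := LinearMap.pi fun j => (σ j).hom.restrictScalars O
  have hf : Function.Injective f := by
    rw [injective_iff_map_eq_zero]
    exact fun m hm => h m fun j => congrFun hm j
  exact ⟨Module.Free.of_equiv (LinearEquiv.ofInjective f hf).symm, Module.Finite.of_injective f hf⟩

theorem isLattice_of_sum_comp_eq_id [IsDomain O] [IsPrincipalIdealRing O] {n : ℕ}
    {M N : ModuleCat.{w} A} (hN : IsLattice O N) (σ : Fin n → (M ⟶ N)) (π : Fin n → (N ⟶ M))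
    (h : ∑ j, σ j ≫ π j = 𝟙 M) : IsLattice O M := by
  refine isLattice_of_jointly_injective hN σ fun m hm => ?_
  have := congrArg (fun f : M ⟶ M => f.hom m) h
  simpa [ModuleCat.hom_sum, hm] using this.symm

/-- Cyclicity of the trace moves each summand of `c • f` from `M` to `N`. -/
theorem sum_endTrace_comp {n : ℕ} {M N : ModuleCat.{w} A} (hM : IsLattice O M)
    (hN : IsLattice O N) (σ : Fin n → (M ⟶ N)) (π : Fin n → (N ⟶ M)) {c : O}
    (h : ∑ j, σ j ≫ π j = c • 𝟙 M) (f : M ⟶ M) :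
    c * endTrace O M f = ∑ j, endTrace O N (π j ≫ f ≫ σ j) := by
  have h1 : c • f = ∑ j, (f ≫ σ j) ≫ π j := by
    simp_rw [Category.assoc]
    rw [← Preadditive.comp_sum, h, Linear.comp_smul, Category.comp_id]
  rw [← smul_eq_mul, ← map_smul, h1, map_sum]
  exact Finset.sum_congr rfl fun j _ => endTrace_comp_comm hM hN _ _

section Regular

variable {R : ModuleCat.{w} A} (e : A ≃ₗ[A] R)

/-- The homomorphism from the regular module that sends `1` to `m`. -/
noncomputable def homOfElem {M : ModuleCat.{w} A} (m : M) : R ⟶ M :=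
  ModuleCat.ofHom ((LinearMap.toSpanSingleton A M m).comp e.symm.toLinearMap)

theorem homOfElem_apply {M : ModuleCat.{w} A} (m : M) (r : R) :
    (homOfElem e m).hom r = e.symm r • m := rfl

theorem homOfElem_one {M : ModuleCat.{w} A} (m : M) : (homOfElem e m).hom (e 1) = m := by
  simp [homOfElem_apply]

theorem homOfElem_hom_one {M : ModuleCat.{w} A} (f : R ⟶ M) : homOfElem e (f.hom (e 1)) = f := by
  ext r
  rw [homOfElem_apply, ← map_smul, ← map_smul, smul_eq_mul, mul_one, e.apply_symm_apply]

/-- Right multiplication on the regular module. -/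
noncomputable def rightMul (O : Type uO) [CommRing O] {A : Type uA} [Ring A] [Algebra O A]
    {R : ModuleCat.{w} A} (e : A ≃ₗ[A] R) : A →ₗ[O] (R ⟶ R) where
  toFun a := homOfElem e (e a)
  map_add' a b := by
    ext r
    change e.symm r • e (a + b) = e.symm r • e a + e.symm r • e b
    rw [map_add, smul_add]
  map_smul' c a := by
    ext r
    change e.symm r • e (c • a) = c • e.symm r • e a
    rw [← smul_comm, ← algebraMap_smul A c a, map_smul, algebraMap_smul]

theorem rightMul_apply (a : A) (r : R) : (rightMul O e a).hom r = e (e.symm r * a) := by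
  change e.symm r • e a = _
  rw [← map_smul, smul_eq_mul]

theorem rightMul_comp (a b : A) : rightMul O e a ≫ rightMul O e b = rightMul O e (a * b) := by
  ext r
  change (rightMul O e b).hom ((rightMul O e a).hom r) = _
  simp [rightMul_apply, mul_assoc]

theorem exists_rightMul_eq (f : R ⟶ R) : ∃ a, rightMul O e a = f :=
  ⟨e.symm (f.hom (e 1)), by
    conv_rhs => rw [← homOfElem_hom_one e f]
    change homOfElem e (e _) = _
    rw [e.apply_symm_apply]⟩

theorem IsRelativeProjectiveElement.isLattice {s : A →ₗ[O] O} {z : A}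
    (hz : IsRelativeProjectiveElement s z) (e : A ≃ₗ[A] R) : IsLattice O R := by
  obtain ⟨n, x, xd, hx, hz⟩ := hz
  let b := x.map (e.restrictScalars O)
  exact ⟨Module.Free.of_basis b, Module.Finite.of_basis b⟩

/-- The projective scalar property enters here: the factor `z_A` of the regular character comes out
as a scalar. -/
theorem endTrace_rightMul {s : A →ₗ[O] O} {c : O} (hs : IsSymmetrisingForm s)
    (hz : IsRelativeProjectiveElement s (algebraMap O A c)) (a : A) :
    endTrace O R (rightMul O e a) = c * s a := by
  obtain ⟨n, x, xd, hx, hz⟩ := hz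
  have h : (rightMul O e a).hom.restrictScalars O =
      (e.restrictScalars O).conj (LinearMap.mulRight O a) := by
    ext r
    exact rightMul_apply (O := O) e a r
  rw [endTrace_apply, h, LinearMap.trace_conj', hs.trace_mulRight hx, ← hz, ← Algebra.smul_def,
    map_smul, smul_eq_mul]

/-- Higman's trace of the coordinate forms of a basis of `M`; projectivity of `M` holds up to the
factor `c`. -/
theorem exists_sum_comp_eq_smul (e : A ≃ₗ[A] R) {s : A →ₗ[O] O} {c : O} (hs : IsSymmetrisingForm s)
    (hz : IsRelativeProjectiveElement s (algebraMap O A c)) {M : ModuleCat.{w} A}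
    (hM : IsLattice O M) : ∃ (n : ℕ) (σ : Fin n → (M ⟶ R)) (π : Fin n → (R ⟶ M)),
      ∑ j, σ j ≫ π j = c • 𝟙 M := by
  obtain ⟨n, x, xd, hx, hz⟩ := hz
  have := hM.free
  have := hM.finite
  let b := (Module.Free.chooseBasis O M).reindex (Fintype.equivFin _)
  refine ⟨_, fun j => ModuleCat.ofHom (e.toLinearMap.comp (higmanTrace hs hx (b.coord j))),
    fun j => homOfElem e (b j), ?_⟩
  ext m
  have h := sum_higmanTrace_coord hs hx b m
  rw [← hz, algebraMap_smul] at h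
  simpa [ModuleCat.hom_sum, homOfElem_apply] using h

end Regular

/-- The action of a central element as an endomorphism. -/
noncomputable def centralHom {z : A} (hz : ∀ a, Commute z a) (M : ModuleCat.{w} A) : M ⟶ M :=
  ModuleCat.ofHom
    { toFun := fun m => z • m
      map_add' := smul_add z
      map_smul' := fun a m => by simp [smul_smul, (hz a).eq] }

theorem centralHom_comm {z : A} (hz : ∀ a, Commute z a) {M N : ModuleCat.{w} A} (f : M ⟶ N) :
    centralHom hz M ≫ f = f ≫ centralHom hz N := by
  ext m
  exact map_smul f.hom z m

theorem rightMul_comp_centralHom {R : ModuleCat.{w} A} (e : A ≃ₗ[A] R) {z : A}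
    (hz : ∀ a, Commute z a) (a : A) :
    rightMul O e a ≫ centralHom hz R = rightMul O e (z * a) := by
  ext r
  change z • (rightMul O e a).hom r = _
  rw [rightMul_apply, rightMul_apply, ← map_smul, smul_eq_mul, ← mul_assoc, (hz _).eq, mul_assoc]

/-- Every symmetric linear form on a symmetric algebra is `s (z * ·)` with `z` central. -/
theorem IsSymmetrisingForm.exists_central {s : A →ₗ[O] O} (hs : IsSymmetrisingForm s)
    (t : A →ₗ[O] O) (ht : ∀ a b, t (a * b) = t (b * a)) :
    ∃ z : A, (∀ a, Commute z a) ∧ ∀ a, t a = s (z * a) := by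
  obtain ⟨z, hz⟩ := hs.bijective.surjective t
  have hz' : ∀ a, t a = s (z * a) := fun a => (LinearMap.congr_fun hz a).symm
  refine ⟨z, fun a => hs.eq_of_forall fun d => ?_, hz'⟩
  rw [mul_assoc, ← hz', ht, hz', ← mul_assoc, hs.symm, ← mul_assoc]

end CategoryTrace

/-! ### Behaviour of traces under an equivalence of module categories. -/

section Equivalence

theorem isSeparator_of_linearEquiv {A : Type uA} [Ring A] {R : ModuleCat.{w} A}
    (e : A ≃ₗ[A] R) : IsSeparator R := by
  rw [isSeparator_def]
  intro X Y f g h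
  ext x
  have := congrArg (fun k : R ⟶ Y => k.hom (e 1)) (h (homOfElem e x))
  simpa [homOfElem_one] using this

/-- The regular module is a direct summand of a finite power of each separator. -/
theorem exists_sum_comp_eq_id {A : Type uA} [Ring A] {R P : ModuleCat.{w} A}
    (e : A ≃ₗ[A] R) (hP : IsSeparator P) :
    ∃ (n : ℕ) (k : Fin n → (R ⟶ P)) (h : Fin n → (P ⟶ R)), ∑ j, k j ≫ h j = 𝟙 R := by
  -- `I` is the trace of `P` in `R`. The quotient map by `I` kills every map from `P`, so it is zero
  -- and `I` contains `e 1`.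
  let I : Submodule A R := ⨆ h : P ⟶ R, LinearMap.range h.hom
  have hq : ModuleCat.ofHom I.mkQ = 0 := by
    refine hP.def _ _ fun h => ?_
    ext y
    have : h.hom y ∈ I := Submodule.mem_iSup_of_mem h ⟨y, rfl⟩
    simpa using this
  have h1 : e 1 ∈ I := by
    rw [← Submodule.Quotient.mk_eq_zero]
    exact congrArg (fun f : R ⟶ ModuleCat.of A (R ⧸ I) => f.hom (e 1)) hq
  rw [Submodule.mem_iSup_iff_exists_finsupp] at h1
  obtain ⟨f, hf, hsum⟩ := h1
  choose y hy using hf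
  refine ⟨_, fun j => homOfElem e (y (f.support.equivFin.symm j)),
    fun j => (f.support.equivFin.symm j).1, ?_⟩
  rw [f.support.equivFin.symm.sum_comp
    (fun h : f.support => homOfElem e (y h) ≫ (h : P ⟶ R)),
    Finset.sum_coe_sort f.support (fun h => homOfElem e (y h) ≫ h)]
  ext r
  have hr : r = e.symm r • e 1 := by rw [← map_smul, smul_eq_mul, mul_one, e.apply_symm_apply]
  conv_rhs => rw [ModuleCat.hom_id, LinearMap.id_apply, hr, ← hsum]
  simp [ModuleCat.hom_sum, Finsupp.sum, homOfElem_apply, Finset.smul_sum, hy]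

variable {O : Type uO} [CommRing O]
  {A : Type uA} [Ring A] [Algebra O A] {A' : Type uA'} [Ring A'] [Algebra O A']
  (F : ModuleCat.{w} A ≌ ModuleCat.{w'} A') [F.functor.Linear O]
  {R : ModuleCat.{w} A} (e : A ≃ₗ[A] R) {R' : ModuleCat.{w'} A'} (e' : A' ≃ₗ[A'] R')

include e e' in
-- The inverse image of `R'` is a separator, so `R` is a summand of a finite power of it; apply the
-- functor and the counit.
theorem exists_sum_comp_eq_id_functor_obj [F.functor.Additive] :
    ∃ (n : ℕ) (k : Fin n → (F.functor.obj R ⟶ R')) (h : Fin n → (R' ⟶ F.functor.obj R)),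
      ∑ j, k j ≫ h j = 𝟙 (F.functor.obj R) := by
  obtain ⟨n, k, h, H⟩ := exists_sum_comp_eq_id e
    ((isSeparator_of_linearEquiv e').of_equivalence F.symm)
  refine ⟨n, fun j => F.functor.map (k j) ≫ F.counit.app R',
    fun j => F.counitInv.app R' ≫ F.functor.map (h j), ?_⟩
  have := congrArg F.functor.map H
  simpa [Functor.map_sum] using this

variable [IsDomain O] [IsPrincipalIdealRing O] {s : A →ₗ[O] O} {s' : A' →ₗ[O] O} {c c' : O}

omit [F.functor.Linear O] in
include e e' in
-- `F(R)` is a summand of a finite power of `R'`, hence a lattice. The Higman maps `M ⟶ R` are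
-- jointly injective even after applying `F`, because `c • 𝟙 M` is mono and `F` preserves
-- monomorphisms.
theorem isLattice_functor_obj [F.functor.Additive] (hs : IsSymmetrisingForm s)
    (hz : IsRelativeProjectiveElement s (algebraMap O A c)) (hc : c ≠ 0)
    {z' : A'} (hz' : IsRelativeProjectiveElement s' z')
    {M : ModuleCat.{w} A} (hM : IsLattice O M) : IsLattice O (F.functor.obj M) := by
  have hR : IsLattice O (F.functor.obj R) := by
    obtain ⟨n, k, h, H⟩ := exists_sum_comp_eq_id_functor_obj F e e'
    exact isLattice_of_sum_comp_eq_id (hz'.isLattice e') k h H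
  obtain ⟨n, σ, π, H⟩ := exists_sum_comp_eq_smul e hs hz hM
  refine isLattice_of_jointly_injective hR (fun j => F.functor.map (σ j)) fun m hm => ?_
  have := hM.free
  have : Mono (c • 𝟙 M) := by
    rw [ModuleCat.mono_iff_injective]
    exact (smul_right_injective M hc : Function.Injective fun m : M => c • m)
  have hmono : Mono (F.functor.map (c • 𝟙 M)) := inferInstance
  apply (ModuleCat.mono_iff_injective _).1 hmono
  rw [← H]
  simp [Functor.map_sum, ModuleCat.hom_sum, hm]

/-- The trace form of the `A`-`A'`-bimodule of an equivalence, in terms of a symmetrising form. -/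
theorem exists_central_endTrace_functor_map (hs : IsSymmetrisingForm s)
    (hs' : IsSymmetrisingForm s')
    (hz' : IsRelativeProjectiveElement s' (algebraMap O A' c')) (hc' : c' ≠ 0) (e' : A' ≃ₗ[A'] R') :
    ∃ z : A, (∀ a, Commute z a) ∧ ∀ a,
      endTrace O (F.functor.obj R) (F.functor.map (rightMul O e a)) = c' * s (z * a) := by
  have : F.functor.Additive := F.functor.additive_of_preserves_binary_products
  obtain ⟨n, k, h, H⟩ := exists_sum_comp_eq_id_functor_obj F e e'
  have hR' := hz'.isLattice e'
  have hR : IsLattice O (F.functor.obj R) := isLattice_of_sum_comp_eq_id hR' k h H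
  let T : A →ₗ[O] (F.functor.obj R ⟶ F.functor.obj R) :=
    (F.functor.mapLinearMap O).comp (rightMul O e)
  -- The trace on `F(R)` divided by `c'`, built from `s'` so that no division in `O` is needed.
  let τ : A →ₗ[O] O :=
    { toFun := fun a => ∑ j, s' (e'.symm ((h j ≫ T a ≫ k j).hom (e' 1)))
      map_add' := fun a b => by simp [← Finset.sum_add_distrib]
      map_smul' := fun d a => by
        simp only [map_smul, Linear.smul_comp, Linear.comp_smul, RingHom.id_apply, smul_eq_mul,
          Finset.mul_sum]
        refine Finset.sum_congr rfl fun j _ => ?_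
        rw [← smul_eq_mul, ← map_smul]
        exact congrArg s' ((e'.restrictScalars O).symm.map_smul d _) }
  have hτ : ∀ a, endTrace O (F.functor.obj R) (T a) = c' * τ a := fun a => by
    have := sum_endTrace_comp hR hR' k h (c := 1) (by rw [H, one_smul]) (T a)
    rw [one_mul] at this
    have hτa : τ a = ∑ j, s' (e'.symm ((h j ≫ T a ≫ k j).hom (e' 1))) := rfl
    rw [this, hτa, Finset.mul_sum]
    refine Finset.sum_congr rfl fun j _ => ?_
    obtain ⟨b, hb⟩ := exists_rightMul_eq (O := O) e' (h j ≫ T a ≫ k j)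
    rw [← hb, endTrace_rightMul e' hs' hz', rightMul_apply, e'.symm_apply_apply,
      e'.symm_apply_apply, one_mul]
  have hT : ∀ a b, T (a * b) = T a ≫ T b := fun a b => by
    change F.functor.map _ = F.functor.map _ ≫ F.functor.map _
    rw [← F.functor.map_comp, rightMul_comp]
  -- `c' τ` is a trace and hence symmetric; cancelling `c'` makes `τ` symmetric.
  obtain ⟨z, hz, hzτ⟩ := hs.exists_central τ fun a b => by
    apply mul_left_cancel₀ hc'
    rw [← hτ, ← hτ, hT, hT, endTrace_comp_comm hR hR]
  exact ⟨z, hz, fun a => by rw [← hzτ, ← hτ]; rfl⟩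

/-- Both traces, multiplied by `c`, become sums of traces of right multiplications, on `F(R)` and on
`R`, where the formula is known. -/
theorem endTrace_functor_map_of_rightMul (hs : IsSymmetrisingForm s)
    (hz : IsRelativeProjectiveElement s (algebraMap O A c)) (hc : c ≠ 0)
    {z' : A'} (hz' : IsRelativeProjectiveElement s' z') (e' : A' ≃ₗ[A'] R')
    {z : A} (hzc : ∀ a, Commute z a)
    (h : ∀ a, endTrace O (F.functor.obj R) (F.functor.map (rightMul O e a)) = c' * s (z * a))
    {M : ModuleCat.{w} A} (hM : IsLattice O M) (f : M ⟶ M) :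
    c * endTrace O (F.functor.obj M) (F.functor.map f) =
      c' * endTrace O M (f ≫ centralHom hzc M) := by
  have : F.functor.Additive := F.functor.additive_of_preserves_binary_products
  have hR := hz.isLattice e
  have hFR := isLattice_functor_obj F e e' hs hz hc hz' hR
  have hFM := isLattice_functor_obj F e e' hs hz hc hz' hM
  obtain ⟨n, σ, π, H⟩ := exists_sum_comp_eq_smul e hs hz hM
  have H' : ∑ j, F.functor.map (σ j) ≫ F.functor.map (π j) = c • 𝟙 _ := by
    have := congrArg F.functor.map H
    simpa [Functor.map_sum, Functor.map_smul] using this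
  apply mul_left_cancel₀ hc
  rw [mul_left_comm c c', sum_endTrace_comp hFM hFR _ _ H', sum_endTrace_comp hM hR _ _ H,
    Finset.mul_sum, Finset.mul_sum]
  refine Finset.sum_congr rfl fun j _ => ?_
  obtain ⟨b, hb⟩ := exists_rightMul_eq (O := O) e (π j ≫ f ≫ σ j)
  rw [← F.functor.map_comp, ← F.functor.map_comp, ← hb, h, Category.assoc, centralHom_comm,
    ← Category.assoc f, ← Category.assoc, hb.symm, rightMul_comp_centralHom,
    endTrace_rightMul e hs hz]
  ring

/-- An equivalence of module categories multiplies traces by a scalar, up to a central unit. -/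
theorem exists_central_unit_endTrace_functor_map (hs : IsSymmetrisingForm s)
    (hz : IsRelativeProjectiveElement s (algebraMap O A c)) (hc : c ≠ 0)
    (hs' : IsSymmetrisingForm s')
    (hz' : IsRelativeProjectiveElement s' (algebraMap O A' c')) (hc' : c' ≠ 0)
    (e : A ≃ₗ[A] R) (e' : A' ≃ₗ[A'] R') :
    ∃ (z : A) (hzc : ∀ a, Commute z a), IsUnit z ∧
      ∀ (M : ModuleCat.{w} A), IsLattice O M → ∀ f : M ⟶ M,
        c * endTrace O (F.functor.obj M) (F.functor.map f) =
          c' * endTrace O M (f ≫ centralHom hzc M) := by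
  have : F.functor.Additive := F.functor.additive_of_preserves_binary_products
  obtain ⟨z, hzc, h⟩ := exists_central_endTrace_functor_map F e hs hs' hz' hc' e'
  have : F.symm.functor.Linear O := F.inverseLinear O
  have : F.symm.functor.Additive := F.symm.functor.additive_of_preserves_binary_products
  obtain ⟨y, hyc, hy⟩ := exists_central_endTrace_functor_map F.symm e' hs' hs hz hc e
  have h1 := fun (M : ModuleCat.{w} A) (hM : IsLattice O M) =>
    endTrace_functor_map_of_rightMul F e hs hz hc hz' e' hzc h hM
  have h2 := fun (M : ModuleCat.{w'} A') (hM : IsLattice O M) =>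
    endTrace_functor_map_of_rightMul F.symm e' hs' hz' hc' hz e hyc hy hM
  refine ⟨z, hzc, ?_, h1⟩
  have hR := hz.isLattice e
  have hFR := isLattice_functor_obj F e e' hs hz hc hz' hR
  have hGFR : IsLattice O (F.inverse.obj (F.functor.obj R)) :=
    isLattice_functor_obj F.symm e' e hs' hz' hc' hz hFR
  -- By fullness, the central element `y` of the inverse formula acts on `F(R)` as the image of a
  -- right multiplication by some `b`, the candidate inverse of `z`.
  obtain ⟨b, hb⟩ := exists_rightMul_eq (O := O) e
    (F.functor.preimage (centralHom hyc (F.functor.obj R)))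
  have hb' : F.functor.map (rightMul O e b) = centralHom hyc (F.functor.obj R) := by
    rw [hb, F.functor.map_preimage]
  -- Going to `A'` and back preserves the trace `c * s a` but also multiplies by `z * b` according
  -- to the two trace formulas.
  have key : ∀ a, s a = s (z * b * a) := fun a => by
    have h3 := h2 _ hFR (F.functor.map (rightMul O e a))
    rw [← centralHom_comm, ← hb', ← F.functor.map_comp, rightMul_comp, h] at h3
    have h4 : endTrace O (F.symm.functor.obj (F.functor.obj R))
        (F.symm.functor.map (F.functor.map (rightMul O e a))) = c * s a := by
      rw [← endTrace_rightMul e hs hz]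
      change endTrace O (F.inverse.obj (F.functor.obj R))
        (F.inverse.map (F.functor.map (rightMul O e a))) = _
      rw [F.inv_fun_map, endTrace_comp_comm hGFR hR]
      simp
    rw [h4] at h3
    apply mul_left_cancel₀ hc
    apply mul_left_cancel₀ hc'
    rw [h3, mul_assoc z]
    ring
  have hzb : z * b = 1 := hs.eq_of_forall fun d => by rw [← key, one_mul]
  exact ⟨⟨z, b, hzb, by rw [← (hzc b).eq, hzb]⟩, rfl⟩

end Equivalence

/-! ### Transfer of the Knörr conditions. -/

section Transfer

theorem IsLattice.congr {O : Type uO} [CommRing O] {U : Type u} [AddCommGroup U] [Module O U]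
    {V : Type v} [AddCommGroup V] [Module O V] (h : IsLattice O U) (e : U ≃ₗ[O] V) :
    IsLattice O V :=
  have := h.free
  have := h.finite
  ⟨Module.Free.of_equiv e, Module.Finite.equiv e⟩

/-- Direct sum decompositions are idempotent endomorphisms, so indecomposability depends only on the
endomorphism ring. -/
theorem IsIndecomposable.of_end_ringEquiv {A : Type uA} [Ring A] {A' : Type uA'} [Ring A']
    {U : Type u} [AddCommGroup U] [Module A U] {U' : Type v} [AddCommGroup U'] [Module A' U']
    (hU : IsIndecomposable A U) (φ : Module.End A U ≃+* Module.End A' U') :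
    IsIndecomposable A' U' where
  nontrivial := by
    have := hU.nontrivial
    by_contra h
    rw [not_nontrivial_iff_subsingleton] at h
    have : Nontrivial (Module.End A' U') := φ.injective.nontrivial
    obtain ⟨f, g, hfg⟩ := exists_pair_ne (Module.End A' U')
    exact hfg (LinearMap.ext fun x => Subsingleton.elim _ _)
  eq_bot_or_eq_bot W W' h := by
    let p : Module.End A' U' := W.projection W' h
    have hp : IsIdempotentElem p := Submodule.isIdempotentElem_projection h
    have hp' : IsIdempotentElem (φ.symm p) := hp.map φ.symm
    have key : φ.symm p = 0 ∨ φ.symm p = 1 := by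
      rcases hU.eq_bot_or_eq_bot _ _ (LinearMap.IsIdempotentElem.isCompl hp') with h0 | h0
      · exact Or.inl (LinearMap.range_eq_bot.1 h0)
      · right
        have hinj := LinearMap.ker_eq_bot.1 h0
        exact LinearMap.ext fun x => hinj (LinearMap.congr_fun hp' x)
    rcases key with h0 | h0
    · left
      have h1 : p = 0 := by simpa using h0
      rw [← Submodule.range_projection h]
      exact LinearMap.range_eq_bot.2 h1
    · right
      have h1 : p = 1 := by simpa using congrArg φ h0
      rw [← Submodule.ker_projection h]
      change LinearMap.ker p = ⊥
      rw [h1]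
      exact LinearMap.ker_id

variable {O : Type uO} [CommRing O]
  {A : Type uA} [Ring A] [Algebra O A] {A' : Type uA'} [Ring A'] [Algebra O A']
  {U : Type u} [AddCommGroup U] [Module O U] [Module A U] [IsScalarTower O A U]
  {U' : Type v} [AddCommGroup U'] [Module O U'] [Module A' U'] [IsScalarTower O A' U']

theorem IsLattice.trace_one (hU : IsLattice O U) :
    LinearMap.trace O U ((1 : Module.End A U).restrictScalars O) = Module.finrank O U := by
  have := hU.free
  have := hU.finite
  exact LinearMap.trace_one O U

theorem IsKnorrLattice.associated_trace [IsDomain O] (hU : IsKnorrLattice O A U)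
    {α : Module.End A U} : Associated (LinearMap.trace O U (α.restrictScalars O))
      (Module.finrank O U : O) ↔ IsUnit α := by
  rw [← hU.trace_eq_iff, Ideal.span_singleton_eq_span_singleton]

/-- Take `α = 1`: the Knörr condition for the automorphism `u` makes its trace associated to the
rank. -/
theorem IsKnorrLattice.associated_finrank [IsDomain O] (hU : IsKnorrLattice O A U)
    (hU' : IsLattice O U') (φ : Module.End A U ≃+* Module.End A' U') {c c' : O}
    {u : Module.End A U} (hu : IsUnit u)
    (h : ∀ α, c * LinearMap.trace O U' ((φ α).restrictScalars O) =
      c' * LinearMap.trace O U ((α * u).restrictScalars O)) :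
    Associated (c * (Module.finrank O U' : O)) (c' * (Module.finrank O U : O)) := by
  have h1 := h 1
  rw [map_one, one_mul, hU'.trace_one] at h1
  rw [h1]
  exact (hU.associated_trace.2 hu).mul_left c'

theorem IsKnorrLattice.of_trace_eq [IsDomain O] (hU : IsKnorrLattice O A U)
    (hU' : IsLattice O U') (φ : Module.End A U ≃+* Module.End A' U') {c c' : O} (hc : c ≠ 0)
    (hc' : c' ≠ 0) {u : Module.End A U} (hu : IsUnit u)
    (h : ∀ α, c * LinearMap.trace O U' ((φ α).restrictScalars O) =
      c' * LinearMap.trace O U ((α * u).restrictScalars O)) :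
    IsKnorrLattice O A' U' where
  isLattice := hU'
  isIndecomposable := hU.isIndecomposable.of_end_ringEquiv φ
  trace_le β := by
    obtain ⟨α, rfl⟩ := φ.surjective β
    -- After scaling by `c`, the divisibility becomes that for `α * u` on `U`, scaled by `c'`.
    rw [Ideal.span_singleton_le_span_singleton, ← mul_dvd_mul_iff_left hc, h,
      (hU.associated_finrank hU' φ hu h).dvd_iff_dvd_left, mul_dvd_mul_iff_left hc',
      ← Ideal.span_singleton_le_span_singleton]
    exact hU.trace_le _
  trace_eq_iff β := by
    obtain ⟨α, rfl⟩ := φ.surjective β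
    have h1 : ∀ {d x y : O}, d ≠ 0 → (Associated (d * x) (d * y) ↔ Associated x y) :=
      fun hd => ⟨fun H => H.of_mul_left (Associated.refl _) hd, fun H => H.mul_left _⟩
    have h0 := hU.associated_finrank hU' φ hu h
    have h2 : ∀ {x : O}, Associated x (c * (Module.finrank O U' : O)) ↔
        Associated x (c' * (Module.finrank O U : O)) :=
      ⟨fun H => H.trans h0, fun H => H.trans h0.symm⟩
    rw [Ideal.span_singleton_eq_span_singleton, ← h1 hc, h,
      h2, h1 hc', hU.associated_trace,
      hu.mul_right_iff, MulEquiv.isUnit_map]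

section EndEquiv

variable (F : ModuleCat.{w} A ≌ ModuleCat.{w'} A') {M : ModuleCat.{w} A}
  (e : U ≃ₗ[A] M) (e' : U' ≃ₗ[A'] F.functor.obj M)

/-- The isomorphism of endomorphism rings given by an equivalence of module categories. -/
noncomputable def functorEndEquiv (M : ModuleCat.{w} A) :
    Module.End A M ≃+* Module.End A' (F.functor.obj M) where
  toFun f := (F.functor.map (ModuleCat.ofHom f)).hom
  invFun g := (F.functor.preimage (ModuleCat.ofHom g)).hom
  left_inv f := by simp
  right_inv g := by simp
  map_mul' f g := by
    change (F.functor.map (ModuleCat.ofHom (f.comp g))).hom = _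
    rw [ModuleCat.ofHom_comp, F.functor.map_comp, ModuleCat.hom_comp]
    rfl
  map_add' f g := by
    have : F.functor.Additive := F.functor.additive_of_preserves_binary_products
    rw [ModuleCat.ofHom_add, F.functor.map_add, ModuleCat.hom_add]

/-- An equivalence of module categories induces isomorphisms of endomorphism rings. -/
noncomputable def endEquiv : Module.End A U ≃+* Module.End A' U' :=
  (e.conjRingEquiv.trans (functorEndEquiv F M)).trans e'.symm.conjRingEquiv

theorem trace_eq_endTrace (α : Module.End A U) :
    LinearMap.trace O U (α.restrictScalars O) =
      endTrace O M (ModuleCat.ofHom (e.conjRingEquiv α)) :=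
  (LinearMap.trace_conj' (α.restrictScalars O) (e.restrictScalars O)).symm

/-- The action of a central element. -/
def centralEnd {z : A} (hz : ∀ a, Commute z a) (U : Type u) [AddCommGroup U] [Module A U] :
    Module.End A U where
  toFun := fun m => z • m
  map_add' := smul_add z
  map_smul' := fun a m => by simp [smul_smul, (hz a).eq]

theorem isUnit_centralEnd {z : A} (hz : ∀ a, Commute z a) (h : IsUnit z) :
    IsUnit (centralEnd hz U) := by
  obtain ⟨⟨z, y, hzy, hyz⟩, rfl⟩ := h
  rw [Module.End.isUnit_iff]
  refine ⟨fun a b hab => ?_, fun a => ⟨y • a, ?_⟩⟩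
  · have := congrArg (y • ·) hab
    simpa [centralEnd, smul_smul, hyz] using this
  · change z • y • a = a
    rw [smul_smul, hzy, one_smul]

theorem trace_endEquiv {c c' : O} {z : A} (hzc : ∀ a, Commute z a)
    (h : ∀ (M : ModuleCat.{w} A), IsLattice O M → ∀ f : M ⟶ M,
        c * endTrace O (F.functor.obj M) (F.functor.map f) =
          c' * endTrace O M (f ≫ centralHom hzc M)) (hU : IsLattice O U) (α : Module.End A U) :
    c * LinearMap.trace O U' ((endEquiv F e e' α).restrictScalars O) =
      c' * LinearMap.trace O U ((α * centralEnd hzc U).restrictScalars O) := by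
  have h1 : F.functor.map (ModuleCat.ofHom (e.conjRingEquiv α)) =
      ModuleCat.ofHom (e'.conjRingEquiv (endEquiv F e e' α)) := by
    ext; simp [endEquiv, functorEndEquiv]
  have h2 : ModuleCat.ofHom (e.conjRingEquiv α) ≫ centralHom hzc M =
      ModuleCat.ofHom (e.conjRingEquiv (α * centralEnd hzc U)) := by
    ext; simp [centralHom, centralEnd]
  rw [trace_eq_endTrace e', trace_eq_endTrace e, ← h1, ← h2, h _ (hU.congr (e.restrictScalars O))]

end EndEquiv

end Transfer

/-! ### Comparing `p`-parts of integers inside `O`. -/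

section Valuation

/-- Integers prime to `p` are units of `O` and `p` is not, so `k` is associated to the power of `p`
that it contains. -/
theorem padicValNat_eq_of_associated {O : Type uO} [CommRing O] [IsDomain O] [IsLocalRing O]
    [CharZero O] (p : ℕ) [Fact p.Prime] [CharP (IsLocalRing.ResidueField O) p] {m n : ℕ}
    (hm : m ≠ 0) (hn : n ≠ 0) (h : Associated (m : O) (n : O)) :
    padicValNat p m = padicValNat p n := by
  have hp : ¬ IsUnit (p : O) := by
    rw [← mem_nonunits_iff, ← IsLocalRing.mem_maximalIdeal, ← IsLocalRing.residue_eq_zero_iff,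
      map_natCast, CharP.cast_eq_zero]
  have hp0 : (p : O) ≠ 0 := by exact_mod_cast (Fact.out : p.Prime).ne_zero
  have key : ∀ k : ℕ, k ≠ 0 → Associated (k : O) ((p : O) ^ padicValNat p k) := fun k hk => by
    obtain ⟨r, hr⟩ := @pow_padicValNat_dvd p k
    have hpr : ¬ p ∣ r := fun hd => by
      apply pow_succ_padicValNat_not_dvd (p := p) hk
      obtain ⟨t, rfl⟩ := hd
      exact ⟨t, by rw [pow_succ, mul_assoc, ← hr]⟩
    have hu : IsUnit (r : O) := by
      by_contra hr'
      rw [← mem_nonunits_iff, ← IsLocalRing.mem_maximalIdeal, ← IsLocalRing.residue_eq_zero_iff,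
        map_natCast, CharP.cast_eq_zero_iff _ p] at hr'
      exact hpr hr'
    conv_lhs => rw [hr]
    push_cast
    exact (associated_mul_unit_left _ _ hu)
  have h1 := ((key m hm).symm.trans h).trans (key n hn)
  have h2 : ∀ {a b : ℕ}, (p : O) ^ a ∣ (p : O) ^ b → a ≤ b := fun H => (pow_dvd_pow_iff hp0 hp).1 H
  exact le_antisymm (h2 h1.dvd) (h2 h1.symm.dvd)

end Valuation

/-! ### Irreducible lattices without scalar extension, and central scalars on them. -/

section Irreducible

/-- `V` is nonzero and all proper quotients `V ⧸ W` are torsion over `O`. -/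
structure HasTorsionQuotients (O : Type uO) [CommRing O] (A : Type uA) [Ring A]
    (V : Type v) [AddCommGroup V] [Module O V] [Module A V] : Prop where
  nontrivial : Nontrivial V
  exists_smul_mem : ∀ W : Submodule A V, W ≠ ⊥ → ∀ x : V, ∃ d : O, d ≠ 0 ∧ d • x ∈ W

variable {O : Type uO} [CommRing O] {A : Type uA} [Ring A] [Algebra O A]

theorem exists_smul_mem_of_finite [IsDomain O] {V : Type v} [AddCommGroup V] [Module O V]
    [Module.Finite O V] (W : Submodule O V) (h : ∀ x : V, ∃ d : O, d ≠ 0 ∧ d • x ∈ W) :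
    ∃ d : O, d ≠ 0 ∧ ∀ x : V, d • x ∈ W := by
  classical
  obtain ⟨S, hS⟩ := (Module.Finite.fg_top : (⊤ : Submodule O V).FG)
  choose d hd hdW using h
  refine ⟨∏ y ∈ S, d y, Finset.prod_ne_zero_iff.2 fun y _ => hd y, fun x => ?_⟩
  have hx : x ∈ Submodule.span O (S : Set V) := hS ▸ Submodule.mem_top
  have : Submodule.span O (S : Set V) ≤ W.comap (LinearMap.lsmul O V (∏ y ∈ S, d y)) := by
    rw [Submodule.span_le]
    intro y hy
    change (∏ y ∈ S, d y) • y ∈ W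
    rw [← Finset.prod_erase_mul S d hy, mul_smul]
    exact W.smul_mem _ (hdW y)
  exact this hx

theorem HasTorsionQuotients.congr {V : Type v} [AddCommGroup V] [Module O V] [Module A V]
    [IsScalarTower O A V] {V' : Type u} [AddCommGroup V'] [Module O V'] [Module A V']
    [IsScalarTower O A V'] (h : HasTorsionQuotients O A V) (e : V ≃ₗ[A] V') :
    HasTorsionQuotients O A V' where
  nontrivial := by
    have := h.nontrivial
    exact e.injective.nontrivial
  exists_smul_mem W hW x := by
    obtain ⟨d, hd, hx⟩ := h.exists_smul_mem (W.comap e.toLinearMap)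
      (fun H => hW (by
        rw [← Submodule.map_comap_eq_of_surjective e.surjective W]
        exact (congrArg _ H).trans (Submodule.map_bot _))) (e.symm x)
    refine ⟨d, hd, ?_⟩
    have : e (d • e.symm x) ∈ W := hx
    rwa [← algebraMap_smul A d (e.symm x), map_smul, e.apply_symm_apply, algebraMap_smul] at this

/-- In categorical terms: for each nonzero monomorphism `j` into `M`, some nonzero multiple of `𝟙 M`
factors through `j`. Finite generation supplies one multiple for all of `M`. -/
theorem HasTorsionQuotients.functor_obj [IsDomain O] {A' : Type uA'} [Ring A'] [Algebra O A']
    (F : ModuleCat.{w} A ≌ ModuleCat.{w'} A') [F.functor.Linear O] {M : ModuleCat.{w} A}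
    (hM : IsLattice O M) (h : HasTorsionQuotients O A M) :
    HasTorsionQuotients O A' (F.functor.obj M) where
  nontrivial := by
    have := h.nontrivial
    by_contra H
    rw [not_nontrivial_iff_subsingleton] at H
    have h0 : 𝟙 (F.functor.obj M) = 0 := by
      ext x
      exact Subsingleton.elim _ _
    have h1 : 𝟙 M = 0 := F.functor.map_injective (by
      have : F.functor.Additive := F.functor.additive_of_preserves_binary_products
      rw [F.functor.map_id, h0, F.functor.map_zero])
    obtain ⟨x, hx⟩ := exists_ne (0 : M)
    exact hx (congrArg (fun f : M ⟶ M => f.hom x) h1)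
  exists_smul_mem W hW x := by
    have := hM.finite
    let i : ModuleCat.of A' W ⟶ F.functor.obj M := ModuleCat.ofHom W.subtype
    have hi : Mono i := (ModuleCat.mono_iff_injective i).2 W.injective_subtype
    obtain ⟨j, hj⟩ : ∃ j : F.inverse.obj (ModuleCat.of A' W) ⟶ M,
        F.functor.map j = F.counit.app _ ≫ i := ⟨_, F.functor.map_preimage _⟩
    have hε : Mono (F.counit.app (ModuleCat.of A' W)) := IsIso.mono_of_iso _
    have hj' : Mono (F.functor.map j) := hj ▸ @mono_comp _ _ _ _ _ _ hε _ hi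
    have hjm : Mono j := F.functor.mono_of_mono_map hj'
    have hjr : LinearMap.range j.hom ≠ ⊥ := by
      intro H
      have : F.functor.Additive := F.functor.additive_of_preserves_binary_products
      have hj0 : j = 0 := ModuleCat.hom_ext (LinearMap.range_eq_bot.1 H)
      rw [hj0, F.functor.map_zero] at hj
      have hi0 : i = 0 := by
        rw [← cancel_epi (F.counit.app (ModuleCat.of A' W)), ← hj, Limits.comp_zero]
      apply hW
      rw [eq_bot_iff]
      intro y hy
      exact congrArg (fun f : ModuleCat.of A' W ⟶ F.functor.obj M => f.hom ⟨y, hy⟩) hi0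
    obtain ⟨d, hd, hdm⟩ := exists_smul_mem_of_finite
      ((LinearMap.range j.hom).restrictScalars O) (h.exists_smul_mem _ hjr)
    refine ⟨d, hd, ?_⟩
    let ψ := LinearEquiv.ofInjective j.hom ((ModuleCat.mono_iff_injective _).1 hjm)
    let g : M ⟶ F.inverse.obj (ModuleCat.of A' W) := ModuleCat.ofHom
      (ψ.symm.toLinearMap.comp (LinearMap.codRestrict (LinearMap.range j.hom)
        (d • 𝟙 M : M ⟶ M).hom hdm))
    have hg : g ≫ j = d • 𝟙 M := by
      ext m
      change j.hom (ψ.symm ⟨_, hdm m⟩) = _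
      have := ψ.apply_symm_apply ⟨_, hdm m⟩
      exact congrArg Subtype.val this
    have hFg : (F.functor.map g ≫ F.counit.app _) ≫ i = d • 𝟙 (F.functor.obj M) := by
      rw [Category.assoc, ← hj, ← F.functor.map_comp, hg, F.functor.map_smul, F.functor.map_id]
    have := congrArg (fun f : F.functor.obj M ⟶ F.functor.obj M => f.hom x) hFg
    change _ = d • x at this
    rw [← this]
    exact ((F.functor.map g ≫ F.counit.app _).hom x : W).2

variable {K : Type uK} [Field K] [Algebra O K]
  {V : Type v} [AddCommGroup V] [Module O V] [Module A V] [IsScalarTower O A V]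

theorem exists_smul_eq_one_tmul [IsDomain O] [IsFractionRing O K] (W : Submodule O V)
    {y : K ⊗[O] V} (hy : y ∈ W.baseChange K) :
    ∃ d : O, d ≠ 0 ∧ ∃ x ∈ W, algebraMap O K d • y = 1 ⊗ₜ[O] x := by
  rw [Submodule.baseChange_eq_span] at hy
  induction hy using Submodule.span_induction with
  | mem y hy =>
    obtain ⟨x, hx, rfl⟩ := hy
    exact ⟨1, one_ne_zero, x, hx, by simp⟩
  | zero => exact ⟨1, one_ne_zero, 0, W.zero_mem, by simp⟩
  | add y z _ _ hy hz =>
    obtain ⟨d, hd, x, hx, h⟩ := hy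
    obtain ⟨d', hd', x', hx', h'⟩ := hz
    refine ⟨d * d', mul_ne_zero hd hd', d' • x + d • x',
      W.add_mem (W.smul_mem _ hx) (W.smul_mem _ hx'), ?_⟩
    rw [smul_add, map_mul, mul_comm, mul_smul, h, mul_comm, mul_smul, h', TensorProduct.tmul_add,
      algebraMap_smul, algebraMap_smul, TensorProduct.tmul_smul, TensorProduct.tmul_smul]
  | smul a y _ hy =>
    obtain ⟨d, hd, x, hx, h⟩ := hy
    obtain ⟨b, t, ht, rfl⟩ := IsFractionRing.div_surjective (A := O) a
    have ht0 := nonZeroDivisors.ne_zero ht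
    have ht1 : algebraMap O K t ≠ 0 := by simpa using ht0
    refine ⟨d * t, mul_ne_zero hd ht0, b • x, W.smul_mem _ hx, ?_⟩
    rw [smul_smul, map_mul, mul_assoc, mul_div_cancel₀ _ ht1, mul_comm, mul_smul, h,
      algebraMap_smul, TensorProduct.tmul_smul]

theorem one_tmul_injective [IsDomain O] [IsFractionRing O K] [Module.Free O V] :
    Function.Injective fun x : V => (1 : K) ⊗ₜ[O] x := by
  intro x y h
  have := Module.Flat.rTensor_preserves_injective_linearMap (M := V) (Algebra.linearMap O K)
    (IsFractionRing.injective O K)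
  apply (TensorProduct.lid O V).symm.injective
  apply this
  simpa using h

/-- The subspace of `K ⊗ V` spanned by an `A`-submodule of `V` is stable under `K ⊗ A`. -/
theorem scalarExtensionAction_mem_baseChange (W : Submodule A V) (a : K ⊗[O] A) {y : K ⊗[O] V}
    (hy : y ∈ (W.restrictScalars O).baseChange K) :
    scalarExtensionAction O K A V a y ∈ (W.restrictScalars O).baseChange K := by
  induction a with
  | zero => simp
  | add a b ha hb =>
    rw [map_add]
    exact Submodule.add_mem _ ha hb
  | tmul k a =>
    rw [Submodule.baseChange_eq_span] at hy
    induction hy using Submodule.span_induction with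
    | mem y hy =>
      obtain ⟨x, hx, rfl⟩ := hy
      change scalarExtensionAction O K A V (k ⊗ₜ[O] a) (1 ⊗ₜ[O] x) ∈ _
      rw [scalarExtensionAction_tmul]
      exact Submodule.tmul_mem_baseChange_of_mem _ (W.smul_mem a hx)
    | zero => simp
    | add y z _ _ hy hz =>
      rw [map_add]
      exact Submodule.add_mem _ hy hz
    | smul c y _ hy =>
      rw [map_smul]
      exact Submodule.smul_mem _ _ hy

theorem IsIrreducibleLattice.hasTorsionQuotients [IsDomain O] [IsFractionRing O K]
    (h : IsIrreducibleLattice O K A V) : HasTorsionQuotients O A V := by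
  have := h.isLattice.free
  let _ : Module (K ⊗[O] A) (K ⊗[O] V) :=
    Module.compHom (K ⊗[O] V) (scalarExtensionAction O K A V).toRingHom
  have hs : IsSimpleModule (K ⊗[O] A) (K ⊗[O] V) := h.isSimple
  refine ⟨?_, fun W hW x => ?_⟩
  · by_contra H
    rw [not_nontrivial_iff_subsingleton] at H
    have := IsSimpleModule.nontrivial (K ⊗[O] A) (K ⊗[O] V)
    obtain ⟨y, hy⟩ := exists_ne (0 : K ⊗[O] V)
    exact hy (Subsingleton.elim _ _)
  -- `K ⊗ W` is a nonzero submodule of a simple module, hence everything; clearing denominators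
  -- gives `d`.
  · let N : Submodule (K ⊗[O] A) (K ⊗[O] V) :=
      { toAddSubmonoid := ((W.restrictScalars O).baseChange K).toAddSubmonoid
        smul_mem' := fun a y hy => scalarExtensionAction_mem_baseChange W a hy }
    have hN : N ≠ ⊥ := by
      obtain ⟨w, hw, hw0⟩ := W.ne_bot_iff.1 hW
      refine N.ne_bot_iff.2 ⟨1 ⊗ₜ w, Submodule.tmul_mem_baseChange_of_mem 1 hw, fun H => hw0 ?_⟩
      apply one_tmul_injective (O := O) (K := K)
      simpa using H
    have hx : (1 : K) ⊗ₜ[O] x ∈ N := by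
      rw [(eq_bot_or_eq_top N).resolve_left hN]
      trivial
    obtain ⟨d, hd, y, hy, hxy⟩ := exists_smul_eq_one_tmul (W.restrictScalars O) hx
    refine ⟨d, hd, ?_⟩
    have : d • x = y := by
      apply one_tmul_injective (O := O) (K := K)
      dsimp only
      rw [← hxy, algebraMap_smul, TensorProduct.tmul_smul]
    rwa [this]

theorem HasTorsionQuotients.isIrreducibleLattice [IsDomain O] [IsFractionRing O K]
    (hV : IsLattice O V) (h : HasTorsionQuotients O A V) : IsIrreducibleLattice O K A V := by
  refine ⟨hV, ?_⟩
  let _ : Module (K ⊗[O] A) (K ⊗[O] V) :=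
    Module.compHom (K ⊗[O] V) (scalarExtensionAction O K A V).toRingHom
  have := hV.free
  have := h.nontrivial
  have hsmul : ∀ (k : K) (y : K ⊗[O] V), (k ⊗ₜ[O] (1 : A)) • y = k • y := fun k y => by
    change scalarExtensionAction O K A V (k ⊗ₜ[O] 1) y = k • y
    induction y with
    | zero => simp
    | add y z hy hz => rw [map_add, hy, hz, smul_add]
    | tmul l x => rw [scalarExtensionAction_tmul, one_smul, TensorProduct.smul_tmul', smul_eq_mul]
  have hnt : Nontrivial (K ⊗[O] V) := (one_tmul_injective (O := O) (K := K) (V := V)).nontrivial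
  have hsm : ∀ (N : Submodule (K ⊗[O] A) (K ⊗[O] V)) (k : K) {y}, y ∈ N → k • y ∈ N :=
    fun N k y hy => by
      rw [← hsmul]
      exact N.smul_mem _ hy
  change IsSimpleModule (K ⊗[O] A) (K ⊗[O] V)
  refine { exists_pair_ne := ⟨⊥, ⊤, bot_ne_top⟩, eq_bot_or_eq_top := fun N => ?_ }
  rw [or_iff_not_imp_left]
  intro hN
  obtain ⟨y, hy, hy0⟩ := N.ne_bot_iff.1 hN
  -- The intersection of `N` with the copy of `V` in `K ⊗ V`.
  let W : Submodule A V :=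
    { carrier := {x | (1 : K) ⊗ₜ[O] x ∈ N}
      add_mem' := fun {x y} hx hy => by
        change (1 : K) ⊗ₜ[O] (x + y) ∈ N
        rw [TensorProduct.tmul_add]
        exact N.add_mem hx hy
      zero_mem' := by
        change (1 : K) ⊗ₜ[O] (0 : V) ∈ N
        rw [TensorProduct.tmul_zero]
        exact N.zero_mem
      smul_mem' := fun a x hx => by
        have : ((1 : K) ⊗ₜ[O] a) • ((1 : K) ⊗ₜ[O] x) = (1 : K) ⊗ₜ[O] (a • x) := by
          change scalarExtensionAction O K A V _ _ = _
          rw [scalarExtensionAction_tmul, one_mul]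
        change (1 : K) ⊗ₜ[O] (a • x) ∈ N
        rw [← this]
        exact N.smul_mem _ hx }
  have hW : W ≠ ⊥ := by
    obtain ⟨d, hd, x, -, hx⟩ := exists_smul_eq_one_tmul (K := K) (⊤ : Submodule O V) (y := y)
      (by rw [Submodule.baseChange_top]; trivial)
    have hd' : algebraMap O K d ≠ 0 := by simpa using hd
    refine W.ne_bot_iff.2 ⟨x, ?_, fun H => ?_⟩
    · change (1 : K) ⊗ₜ[O] x ∈ N
      rw [← hx]
      exact hsm N _ hy
    · rw [H, TensorProduct.tmul_zero] at hx
      exact (smul_ne_zero hd' hy0) hx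
  rw [eq_top_iff]
  rintro z -
  induction z with
  | zero => exact N.zero_mem
  | add y z hy hz => exact N.add_mem hy hz
  | tmul k x =>
    obtain ⟨d, hd, hdx⟩ := h.exists_smul_mem W hW x
    have hd' : algebraMap O K d ≠ 0 := by simpa using hd
    have hdx' : (1 : K) ⊗ₜ[O] (d • x) ∈ N := hdx
    have : k ⊗ₜ[O] x = (k * (algebraMap O K d)⁻¹) • ((1 : K) ⊗ₜ[O] (d • x)) := by
      rw [TensorProduct.tmul_smul, ← algebraMap_smul K d, smul_smul, mul_assoc,
        inv_mul_cancel₀ hd', mul_one, TensorProduct.smul_tmul', smul_eq_mul, mul_one]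
    rw [this]
    exact hsm N _ hdx'

/-- Over a split algebra, central elements act as scalars on irreducible lattices. -/
theorem IsIrreducibleLattice.exists_scalar [IsDomain O] [IsFractionRing O K]
    {V : Type uA} [AddCommGroup V] [Module O V] [Module A V] [IsScalarTower O A V]
    (hss : IsSplitSemisimple K (K ⊗[O] A)) (h : IsIrreducibleLattice O K A V)
    {z : A} (hzc : ∀ a, Commute z a) : ∃ m : O, ∀ x : V, z • x = m • x := by
  have := h.isLattice.free
  have := h.hasTorsionQuotients.nontrivial
  let _ : Module (K ⊗[O] A) (K ⊗[O] V) :=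
    Module.compHom (K ⊗[O] V) (scalarExtensionAction O K A V).toRingHom
  have hs : IsSimpleModule (K ⊗[O] A) (K ⊗[O] V) := h.isSimple
  have hcomm : ∀ a : K ⊗[O] A, Commute ((1 : K) ⊗ₜ[O] z) a := fun a => by
    induction a with
    | zero => exact Commute.zero_right _
    | add a b ha hb => exact ha.add_right hb
    | tmul k a => simp [Commute, SemiconjBy, (hzc a).eq]
  obtain ⟨k, hk⟩ := hss.split (K ⊗[O] V) hs (centralEnd hcomm _)
  have hk' : ∀ x : V, (1 : K) ⊗ₜ[O] (z • x) = k ⊗ₜ[O] x := fun x => by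
    have := hk (1 ⊗ₜ x)
    change scalarExtensionAction O K A V (1 ⊗ₜ z) (1 ⊗ₜ x) =
      scalarExtensionAction O K A V (k ⊗ₜ 1) (1 ⊗ₜ x) at this
    simpa [scalarExtensionAction_tmul] using this
  let b := Module.Free.chooseBasis O V
  obtain ⟨i⟩ := b.index_nonempty
  -- The eigenvalue `k` lies in `O`, being a coordinate of `z • b i` in an `O`-basis.
  have hm : algebraMap O K (b.repr (z • b i) i) = k := by
    have := congrArg (fun y => (b.baseChange K).repr y i) (hk' (b i))
    simpa [Algebra.smul_def] using this
  refine ⟨b.repr (z • b i) i, fun x => ?_⟩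
  apply one_tmul_injective (O := O) (K := K)
  dsimp only
  rw [hk', ← hm, TensorProduct.tmul_smul, TensorProduct.smul_tmul', Algebra.smul_def, mul_one]

theorem IsIrreducibleLattice.exists_unit_scalar [IsDomain O] [IsFractionRing O K]
    {V : Type uA} [AddCommGroup V] [Module O V] [Module A V] [IsScalarTower O A V]
    (hss : IsSplitSemisimple K (K ⊗[O] A)) (h : IsIrreducibleLattice O K A V)
    {z : A} (hzc : ∀ a, Commute z a) (hz : IsUnit z) :
    ∃ m : O, IsUnit m ∧ ∀ x : V, z • x = m • x := by
  have := h.isLattice.free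
  have := h.hasTorsionQuotients.nontrivial
  obtain ⟨m, hm⟩ := h.exists_scalar hss hzc
  refine ⟨m, ?_, hm⟩
  let b := Module.Free.chooseBasis O V
  obtain ⟨i⟩ := b.index_nonempty
  -- Surjectivity of `z` makes the basis vector `b i` a multiple of `m`; its coordinate 1 shows that
  -- `m` is a unit.
  obtain ⟨x, hx⟩ := ((Module.End.isUnit_iff _).1 (isUnit_centralEnd (U := V) hzc hz)).2 (b i)
  have hx' : m • x = b i := (hm x).symm.trans hx
  have := congrArg (fun y => b.repr y i) hx'
  simp only [map_smul, Finsupp.smul_apply, smul_eq_mul, Module.Basis.repr_self,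
    Finsupp.single_eq_same] at this
  exact IsUnit.of_mul_eq_one _ this

/-- A nonzero algebra which is free of finite rank has an irreducible lattice. -/
theorem exists_isIrreducibleLattice [IsDomain O] [IsPrincipalIdealRing O] [IsFractionRing O K]
    [Nontrivial A] (hA : IsLattice O A) :
    ∃ V : Submodule A A, IsIrreducibleLattice O K A V := by
  have := hA.free
  have := hA.finite
  have hlat : ∀ V : Submodule A A, IsLattice O V := fun V => by
    have h1 : Module.Free O (V.restrictScalars O) := inferInstance
    have h2 : Module.Finite O (V.restrictScalars O) := inferInstance
    exact ⟨h1, h2⟩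
  -- A nonzero left ideal of least rank: its nonzero submodules have the same rank, so the quotients
  -- have rank 0 and are torsion.
  obtain ⟨V, hV, hmin⟩ := exists_minimalFor_of_wellFoundedLT
    (fun V : Submodule A A => V ≠ ⊥) (fun V => Module.finrank O V) ⟨⊤, top_ne_bot⟩
  refine ⟨V, HasTorsionQuotients.isIrreducibleLattice (hlat V)
    ⟨Submodule.nontrivial_iff_ne_bot.2 hV, fun W hW x => ?_⟩⟩
  have := (hlat V).free
  have := (hlat V).finite
  have hle : Module.finrank O V ≤ Module.finrank O (W.restrictScalars O) := by
    have h1 : W.map V.subtype ≠ ⊥ := fun H => hW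
      (Submodule.map_injective_of_injective V.injective_subtype (by rw [H, Submodule.map_bot]))
    have h2 : Module.finrank O (W.map V.subtype) = Module.finrank O W :=
      (((Submodule.equivMapOfInjective _ V.injective_subtype W).restrictScalars O).finrank_eq).symm
    have h3 := Submodule.finrank_le (W.restrictScalars O)
    have h4 := hmin h1 (by
      change Module.finrank O (W.map V.subtype) ≤ _
      rw [h2]
      exact h3)
    change _ ≤ Module.finrank O (W.map V.subtype) at h4
    rwa [h2] at h4
  have h0 : Module.finrank O (V ⧸ W.restrictScalars O) = 0 := by
    have := Submodule.finrank_quotient_add_finrank (W.restrictScalars O)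
    omega
  rw [Module.finrank_eq_zero_iff] at h0
  obtain ⟨d, hd, hdx⟩ := h0 (Submodule.Quotient.mk x)
  exact ⟨d, hd, by simpa [← Submodule.Quotient.mk_smul] using hdx⟩

end Irreducible

/-! ### Heights and the conclusion. -/

section Height

/-- `minRankExponent` ranges over the universe of the algebra, whereas equivalences act in a larger
one. A lattice is in bijection with a finite power of `O`, and `O` embeds in `B`. -/
theorem IsLattice.exists_small {O : Type uO} [CommRing O] {B : Type u} [Ring B] [Algebra O B]
    [Nontrivial B] (hB : IsLattice O B) {N : ModuleCat.{w} B} (hN : IsLattice O N) :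
    ∃ (V : Type u) (_ : AddCommGroup V) (_ : Module O V) (_ : Module B V)
      (_ : IsScalarTower O B V), Nonempty (V ≃ₗ[B] N) := by
  have := hB.free
  have := hN.free
  have := hN.finite
  have : Small.{u} O := small_of_injective (FaithfulSMul.algebraMap_injective O B)
  have : Small.{u} N := small_of_injective
    (Module.Free.chooseBasis O N).equivFun.toEquiv.injective
  let _ : Module O (Shrink.{u} N) := Module.compHom _ (algebraMap O B)
  exact ⟨Shrink.{u} N, inferInstance, inferInstance, inferInstance,
    ⟨fun a b x => by rw [Algebra.smul_def, mul_smul]; rfl⟩, ⟨Shrink.linearEquiv B N⟩⟩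

theorem HasProjectiveScalarProperty.isLattice {O : Type uO} [CommRing O] {A : Type uA} [Ring A]
    [Algebra O A] (h : HasProjectiveScalarProperty O A) : IsLattice O A := by
  obtain ⟨s, hs, c, n, x, xd, hx, hz⟩ := h
  exact ⟨Module.Free.of_basis x, Module.Finite.of_basis x⟩

/-- If `c = 0`, the trace of the identity of `A`, which is its rank, would vanish in `O`. -/
theorem ne_zero_of_isRelativeProjectiveElement {O : Type uO} [CommRing O] [CharZero O]
    [Nontrivial O] {A : Type uA} [Ring A] [Algebra O A] [Nontrivial A] {s : A →ₗ[O] O} {c : O}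
    (hs : IsSymmetrisingForm s) (hz : IsRelativeProjectiveElement s (algebraMap O A c)) :
    c ≠ 0 := by
  rintro rfl
  obtain ⟨n, x, xd, hx, hz⟩ := hz
  have h2 := hs.trace_mulRight hx 1
  rw [← hz, map_zero, zero_mul, map_zero, LinearMap.mulRight_one] at h2
  have := Module.Free.of_basis x
  have := Module.Finite.of_basis x
  rw [LinearMap.trace_id, Module.finrank_eq_card_basis x] at h2
  have h3 : n = 0 := by simpa using h2
  subst h3
  have : Subsingleton A := x.repr.toEquiv.subsingleton
  exact not_subsingleton A this

theorem sInf_add_eq_of_shift {S T : Set ℕ} {a b : ℕ} (hS : S.Nonempty)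
    (h1 : ∀ e ∈ S, ∃ f ∈ T, a + e = b + f) (h2 : ∀ f ∈ T, ∃ e ∈ S, a + e = b + f) :
    a + sInf S = b + sInf T := by
  obtain ⟨f, hf, hef⟩ := h1 _ (Nat.sInf_mem hS)
  obtain ⟨e, he, hef'⟩ := h2 _ (Nat.sInf_mem (⟨f, hf⟩ : T.Nonempty))
  have h3 := Nat.sInf_le hf
  have h4 := Nat.sInf_le he
  omega

theorem IsLattice.finrank_ne_zero {O : Type uO} [CommRing O] [Nontrivial O]
    {V : Type v} [AddCommGroup V] [Module O V] (h : IsLattice O V) [Nontrivial V] :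
    Module.finrank O V ≠ 0 := by
  have := h.free
  have := h.finite
  exact (Module.finrank_pos_iff_of_free O V).2 inferInstance |>.ne'

/-- Cross-multiplying cancels `c` and `c'`, which leaves an association between integers. -/
theorem padicValNat_add_eq_of_associated {O : Type uO} [CommRing O] [IsDomain O] [IsLocalRing O]
    [CharZero O] (p : ℕ) [Fact p.Prime] [CharP (IsLocalRing.ResidueField O) p] {c c' : O}
    (hc : c ≠ 0) (hc' : c' ≠ 0) {m m' n n' : ℕ} (hm : m ≠ 0) (hm' : m' ≠ 0) (hn : n ≠ 0)
    (hn' : n' ≠ 0) (h : Associated (c * (m' : O)) (c' * (m : O)))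
    (h' : Associated (c * (n' : O)) (c' * (n : O))) :
    padicValNat p m' + padicValNat p n = padicValNat p m + padicValNat p n' := by
  rw [← padicValNat.mul hm' hn, ← padicValNat.mul hm hn']
  refine padicValNat_eq_of_associated (O := O) p (mul_ne_zero hm' hn) (mul_ne_zero hm hn') ?_
  have h1 := h.mul_mul h'.symm
  have h2 : Associated (c * c' * (m' * n : ℕ)) (c * c' * (m * n' : ℕ)) := by
    have h3 : c * c' * (m' * n : ℕ) = c * m' * (c' * n) := by push_cast; ring
    have h4 : c * c' * (m * n' : ℕ) = c' * m * (c * n') := by push_cast; ring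
    rwa [h3, h4]
  exact h2.of_mul_left (Associated.refl _) (mul_ne_zero hc hc')

section Minimum

variable {O : Type uO} [CommRing O] [IsDomain O]
  {K : Type uK} [Field K] [Algebra O K] [IsFractionRing O K]
  {A : Type uA} [Ring A] [Algebra O A] {A' : Type uA'} [Ring A'] [Algebra O A']
  (F : ModuleCat.{max uA uA'} A ≌ ModuleCat.{max uA uA'} A') [F.functor.Linear O]
  {c c' : O} {z : A} (hzc : ∀ a, Commute z a)

/-- Irreducible lattices that correspond to each other have ranks with a fixed quotient, up to
units. -/
theorem IsIrreducibleLattice.functor_obj (hss : IsSplitSemisimple K (K ⊗[O] A)) (hzu : IsUnit z)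
    (htr : ∀ (M : ModuleCat.{max uA uA'} A), IsLattice O M → ∀ f : M ⟶ M,
        c * endTrace O (F.functor.obj M) (F.functor.map f) =
          c' * endTrace O M (f ≫ centralHom hzc M))
    {V : Type uA} [AddCommGroup V] [Module O V] [Module A V] [IsScalarTower O A V]
    {V' : Type uA'} [AddCommGroup V'] [Module O V'] [Module A' V'] [IsScalarTower O A' V']
    {M : ModuleCat.{max uA uA'} A} (e : V ≃ₗ[A] M) (e' : V' ≃ₗ[A'] F.functor.obj M)
    (hV : IsIrreducibleLattice O K A V) (hV' : IsLattice O V') :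
    IsIrreducibleLattice O K A' V' ∧
      Associated (c * (Module.finrank O V' : O)) (c' * (Module.finrank O V : O)) := by
  refine ⟨HasTorsionQuotients.isIrreducibleLattice hV' (((hV.hasTorsionQuotients.congr
    e).functor_obj F (hV.isLattice.congr (e.restrictScalars O))).congr e'.symm), ?_⟩
  -- Splitness turns the central unit `z` into a unit scalar, so the trace formula at the identity
  -- compares the ranks.
  obtain ⟨m, hm, hmz⟩ := hV.exists_unit_scalar hss hzc hzu
  have h := trace_endEquiv (O := O) F e e' hzc htr hV.isLattice 1
  have h1 : ((1 * centralEnd hzc V : Module.End A V).restrictScalars O) =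
      m • ((1 : Module.End A V).restrictScalars O) := LinearMap.ext hmz
  rw [map_one, hV'.trace_one, h1, map_smul, hV.isLattice.trace_one, smul_eq_mul] at h
  rw [h]
  exact (associated_unit_mul_left _ _ hm).mul_left c'

theorem height_eq_of_associated [IsDiscreteValuationRing O] [CharZero O] (p : ℕ)
    [Fact p.Prime] [CharP (IsLocalRing.ResidueField O) p] [Nontrivial A] [Nontrivial A']
    (hA : IsLattice O A) (hA' : IsLattice O A')
    (hss : IsSplitSemisimple K (K ⊗[O] A)) (hc : c ≠ 0) (hc' : c' ≠ 0) (hzu : IsUnit z)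
    (htr : ∀ (M : ModuleCat.{max uA uA'} A), IsLattice O M → ∀ f : M ⟶ M,
        c * endTrace O (F.functor.obj M) (F.functor.map f) =
          c' * endTrace O M (f ≫ centralHom hzc M))
    (hF : ∀ {M : ModuleCat.{max uA uA'} A}, IsLattice O M → IsLattice O (F.functor.obj M))
    (hG : ∀ {M : ModuleCat.{max uA uA'} A'}, IsLattice O M → IsLattice O (F.inverse.obj M))
    {U : Type u} [AddCommGroup U] [Module O U] {U' : Type v} [AddCommGroup U'] [Module O U']
    (hU : Module.finrank O U ≠ 0) (hU' : Module.finrank O U' ≠ 0)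
    (h : Associated (c * (Module.finrank O U' : O)) (c' * (Module.finrank O U : O))) :
    height p O K A U = height p O K A' U' := by
  have hval : ∀ {n n' : ℕ}, n ≠ 0 → n' ≠ 0 → Associated (c * (n' : O)) (c' * (n : O)) →
      padicValNat p (Module.finrank O U') + padicValNat p n =
        padicValNat p (Module.finrank O U) + padicValNat p n' :=
    fun hn hn' H => padicValNat_add_eq_of_associated p hc hc' hU hU' hn hn' h H
  have key : padicValNat p (Module.finrank O U') + minRankExponent p O K A =
      padicValNat p (Module.finrank O U) + minRankExponent p O K A' := by
    refine sInf_add_eq_of_shift ?_ ?_ ?_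
    -- On an empty set `sInf` would be 0 by default and would not shift.
    · obtain ⟨V, hV⟩ := exists_isIrreducibleLattice (K := K) hA
      exact ⟨_, V, inferInstance, inferInstance, inferInstance, inferInstance, hV, rfl⟩
    · rintro _ ⟨V, _, _, _, _, hV, rfl⟩
      obtain ⟨M, ⟨e⟩⟩ : ∃ M : ModuleCat.{max uA uA'} A, Nonempty (V ≃ₗ[A] M) :=
        ⟨ModuleCat.of A (ULift.{uA'} V), ⟨ULift.moduleEquiv.symm⟩⟩
      obtain ⟨V', _, _, _, _, ⟨e'⟩⟩ :=
        hA'.exists_small (hF (hV.isLattice.congr (e.restrictScalars O)))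
      have hV'l := (hF (hV.isLattice.congr (e.restrictScalars O))).congr
        (e'.restrictScalars O).symm
      obtain ⟨hV', hVV'⟩ := hV.functor_obj F hzc hss hzu htr e e' hV'l
      have := hV.hasTorsionQuotients.nontrivial
      have := hV'.hasTorsionQuotients.nontrivial
      exact ⟨_, ⟨V', _, _, _, _, hV', rfl⟩,
        hval hV.isLattice.finrank_ne_zero hV'l.finrank_ne_zero hVV'⟩
    · rintro _ ⟨V', _, _, _, _, hV', rfl⟩
      have : F.symm.functor.Linear O := F.inverseLinear O
      obtain ⟨N, ⟨e'⟩⟩ : ∃ N : ModuleCat.{max uA uA'} A', Nonempty (V' ≃ₗ[A'] N) :=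
        ⟨ModuleCat.of A' (ULift.{uA} V'), ⟨ULift.moduleEquiv.symm⟩⟩
      have hN : IsLattice O N := hV'.isLattice.congr (e'.restrictScalars O)
      have hGN : IsLattice O (F.inverse.obj N) := hG hN
      obtain ⟨V, _, _, _, _, ⟨e⟩⟩ := hA.exists_small hGN
      have hVl := hGN.congr (e.restrictScalars O).symm
      have hT : HasTorsionQuotients O A (F.inverse.obj N) :=
        (hV'.hasTorsionQuotients.congr e').functor_obj F.symm hN
      have hV : IsIrreducibleLattice O K A V :=
        HasTorsionQuotients.isIrreducibleLattice hVl (hT.congr e.symm)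
      -- The rank comparison is applied from `A` to `A'`, to the inverse image of `V'`, so that
      -- splitness is needed only for `A`.
      obtain ⟨-, hVV'⟩ := hV.functor_obj F hzc hss hzu htr e
        (e'.trans (F.counitIso.app N).symm.toLinearEquiv) hV'.isLattice
      have := hV.hasTorsionQuotients.nontrivial
      have := hV'.hasTorsionQuotients.nontrivial
      exact ⟨_, ⟨V, _, _, _, _, hV, rfl⟩,
        hval hVl.finrank_ne_zero hV'.isLattice.finrank_ne_zero hVV'⟩
  unfold height
  omega

end Minimum

theorem isKnorrLattice_and_height_eq
    (p : ℕ) [Fact p.Prime]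
    (O : Type uO) [CommRing O] [IsDomain O] [IsDiscreteValuationRing O]
    [CharP (IsLocalRing.ResidueField O) p]
    (K : Type uK) [Field K] [CharZero K] [Algebra O K] [IsFractionRing O K]
    (A : Type uA) [Ring A] [Algebra O A]
    (A' : Type uA') [Ring A'] [Algebra O A']
    (hss : IsSplitSemisimple K (K ⊗[O] A))
    (hA : HasProjectiveScalarProperty O A)
    (hA' : HasProjectiveScalarProperty O A')
    (E : MoritaEquivalence O A A')
    (U : Type (max uA uA')) [AddCommGroup U] [Module O U] [Module A U] [IsScalarTower O A U]
    (hU : IsKnorrLattice O A U)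
    (U' : Type (max uA uA')) [AddCommGroup U'] [Module O U'] [Module A' U'] [IsScalarTower O A' U']
    (hUU' : Nonempty (E.eqv.functor.obj (ModuleCat.of A U) ≅ ModuleCat.of A' U')) :
    IsKnorrLattice O A' U' ∧
      height p O K A U = height p O K A' U' := by
  obtain ⟨i⟩ := hUU'
  have : CharZero O := by
    refine ⟨fun m n h => ?_⟩
    have := congrArg (algebraMap O K) h
    simpa using this
  have hUnt := hU.isIndecomposable.nontrivial
  have hAnt : Nontrivial A := Module.nontrivial A U
  have hAl := hA.isLattice
  have hAl' := hA'.isLattice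
  obtain ⟨s, hs, c, hz⟩ := hA
  obtain ⟨s', hs', c', hz'⟩ := hA'
  let F : ModuleCat.{max uA uA'} A ≌ ModuleCat.{max uA uA'} A' := E.eqv
  have hlin : F.functor.Linear O := E.linear
  have hadd : F.functor.Additive := F.functor.additive_of_preserves_binary_products
  have hlin' : F.symm.functor.Linear O := F.inverseLinear O
  have hadd' : F.symm.functor.Additive := F.symm.functor.additive_of_preserves_binary_products
  obtain ⟨M, ⟨e₀⟩, ⟨e₀'⟩⟩ : ∃ M : ModuleCat.{max uA uA'} A,
      Nonempty (U ≃ₗ[A] M) ∧ Nonempty (U' ≃ₗ[A'] F.functor.obj M) :=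
    ⟨ModuleCat.of A U, ⟨LinearEquiv.refl A U⟩, ⟨i.symm.toLinearEquiv⟩⟩
  have hU'nt : Nontrivial U' :=
    (hU.isIndecomposable.of_end_ringEquiv (endEquiv F e₀ e₀')).nontrivial
  have hA'nt : Nontrivial A' := Module.nontrivial A' U'
  have hc := ne_zero_of_isRelativeProjectiveElement hs hz
  have hc' := ne_zero_of_isRelativeProjectiveElement hs' hz'
  -- Copies of the regular modules in the universe on which the equivalence acts.
  let R : ModuleCat.{max uA uA'} A := ModuleCat.of A (ULift.{uA'} A)
  let R' : ModuleCat.{max uA uA'} A' := ModuleCat.of A' (ULift.{uA} A')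
  let r : A ≃ₗ[A] R := ULift.moduleEquiv.symm
  let r' : A' ≃ₗ[A'] R' := ULift.moduleEquiv.symm
  obtain ⟨z, hzc, hzu, htr⟩ :=
    exists_central_unit_endTrace_functor_map F hs hz hc hs' hz' hc' r r'
  have hlat : ∀ {M : ModuleCat.{max uA uA'} A}, IsLattice O M → IsLattice O (F.functor.obj M) :=
    fun h => isLattice_functor_obj F r r' hs hz hc hz' h
  have hlat' : ∀ {M : ModuleCat.{max uA uA'} A'}, IsLattice O M → IsLattice O (F.inverse.obj M) :=
    fun h => isLattice_functor_obj F.symm r' r hs' hz' hc' hz h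
  have hU'l : IsLattice O U' :=
    (hlat (hU.isLattice.congr (e₀.restrictScalars O))).congr (e₀'.restrictScalars O).symm
  have htrU := trace_endEquiv (O := O) F e₀ e₀' hzc htr hU.isLattice
  have hzU : IsUnit (centralEnd hzc U) := isUnit_centralEnd hzc hzu
  refine ⟨hU.of_trace_eq hU'l _ hc hc' hzU htrU, ?_⟩
  have hassoc := hU.associated_finrank hU'l _ hzU htrU
  have := hU'nt
  exact height_eq_of_associated F hzc p hAl hAl' hss hc hc' hzu htr hlat hlat'
    hU.isLattice.finrank_ne_zero hU'l.finrank_ne_zero hassoc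

end Height

end SymmAlg

theorem mainTheorem7
    (p : ℕ) [Fact p.Prime]
    (O : Type uO) [CommRing O] [IsDomain O] [IsDiscreteValuationRing O]
    [IsAdicComplete (IsLocalRing.maximalIdeal O) O]
    [CharP (IsLocalRing.ResidueField O) p]
    (K : Type uK) [Field K] [CharZero K] [Algebra O K] [IsFractionRing O K]
    (A : Type uA) [Ring A] [Algebra O A]
    (A' : Type uA') [Ring A'] [Algebra O A']
    (hss : SymmAlg.IsSplitSemisimple K (K ⊗[O] A))
    (hA : SymmAlg.HasProjectiveScalarProperty O A)
    (hA' : SymmAlg.HasProjectiveScalarProperty O A')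
    (E : MoritaEquivalence O A A')
    (U : Type (max uA uA')) [AddCommGroup U] [Module O U] [Module A U] [IsScalarTower O A U]
    (hU : SymmAlg.IsKnorrLattice O A U)
    (U' : Type (max uA uA')) [AddCommGroup U'] [Module O U'] [Module A' U'] [IsScalarTower O A' U']
    (hUU' : Nonempty (E.eqv.functor.obj (ModuleCat.of A U) ≅ ModuleCat.of A' U')) :
    SymmAlg.IsKnorrLattice O A' U' ∧
      SymmAlg.height p O K A U = SymmAlg.height p O K A' U' := by
  exact SymmAlg.isKnorrLattice_and_height_eq p O K A A' hss hA hA' E U hU U' hUU'
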